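/- Let $\mathcal H\cong\mathbb C^d$ be a finite-dimensional Hilbert space. Call a linear map $\mathcal E:\mathcal B(\mathcal H)\to\mathcal B(\mathcal H)$ CPTP if it is completely positive and trace preserving, and call it a \emph{CPTP projection onto} a set $\mathcal A\subseteq\mathcal B(\mathcal H)$ if it is CPTP, $\mathcal E^2=\mathcal E$, and its image (equivalently, its set of fixed points) is $\mathcal A$. Density operators are positive-semidefinite operators of trace one. \textbf{Theorem (Full-rank fixed-set stabilization).} Let $\mathcal E_1,\dots,\mathcal E_r$ be CPTP projections onto $\mathcal A_1,\dots,\mathcal A_r$, respectively, and assume that $\hat{\mathcal A}=\bigcap_{i=1}^r\mathcal A_i$ contains a density operator $\rho$ of full rank. Then there is exactly one CPTP projection $\mathcal E_{\hat{\mathcal A}}$ onto $\hat{\mathcal A}$, and for every density operator $\tau$ on $\mathcal H$, $$\lim_{n\to\infty}(\mathcal E_r\cdots\mathcal E_1)^n(\tau)=\mathcal E_{\hat{\mathcal A}}(\tau).$$ -/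

import Mathlib

open scoped Matrix.Norms.L2Operator MatrixOrder in
/-- A linear map on `n × n` complex matrices is CPTP if it is completely positive (Mathlib's notion,
for the C⋆-algebra of matrices with the operator norm and the Loewner order) and trace preserving. -/
def IsCPTP {n : Type*} [Fintype n] [DecidableEq n]
    (E : Matrix n n ℂ →ₗ[ℂ] Matrix n n ℂ) : Prop :=
  (∃ φ : CompletelyPositiveMap (Matrix n n ℂ) (Matrix n n ℂ), φ.toLinearMap = E) ∧
    ∀ X : Matrix n n ℂ, (E X).trace = X.trace

/-- `E` is a CPTP projection onto the set `A`: an idempotent CPTP map whose image is `A`. Since `E`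
is idempotent, its image is also its set of fixed points. -/
structure IsCPTPProjectionOnto {n : Type*} [Fintype n] [DecidableEq n]
    (E : Matrix n n ℂ →ₗ[ℂ] Matrix n n ℂ) (A : Set (Matrix n n ℂ)) : Prop where
  isCPTP : IsCPTP E
  idempotent : E ∘ₗ E = E
  range_eq : Set.range E = A

open scoped ComplexOrder in
/-- Density operators: positive-semidefinite matrices of trace one. -/
def IsDensity {n : Type*} [Fintype n] (τ : Matrix n n ℂ) : Prop :=
  τ.PosSemidef ∧ τ.trace = 1

/-- One cycle `E_r ∘ ⋯ ∘ E_1`, in which `E_1` (index `0`) is applied first. -/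
def cycleMap {n : Type*} : (r : ℕ) → (Fin r → (Matrix n n ℂ →ₗ[ℂ] Matrix n n ℂ)) →
    (Matrix n n ℂ →ₗ[ℂ] Matrix n n ℂ)
  | 0, _ => LinearMap.id
  | r + 1, E => E (Fin.last r) ∘ₗ cycleMap r (fun i => E i.castSucc)

/-! The full-rank `ρ` makes matrices a Hilbert space with `‖X‖² = tr (X ρ⁻¹ X*)`. A Schwarz
inequality (`IsCPTP.mul_inv_mul_le`) together with trace preservation makes every CPTP map fixing
`ρ` a contraction for this norm, so every CPTP projection fixing `ρ` is an orthogonal projection.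
Uniqueness follows, since an orthogonal projection is determined by its range. Convergence is von
Neumann–Halperin alternating projection: a cycle that preserves a norm fixes the vector at each
factor, so in finite dimension the cycle strictly contracts the complement of the common fixed
space. The limit is CPTP because the CPTP conditions are closed. -/

/-! ### Contractions of a finite-dimensional Hilbert space -/

section Contraction

open Filter Topology

variable {V : Type*} [NormedAddCommGroup V] [InnerProductSpace ℂ V] [FiniteDimensional ℂ V]

/-- A fixed vector of a contraction is also fixed by its adjoint. -/
theorem inner_map_eq_of_contraction {S : V →ₗ[ℂ] V} (hS : ∀ x, ‖S x‖ ≤ ‖x‖) {x : V}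
    (hx : S x = x) (y : V) : inner ℂ x (S y) = inner ℂ x y := by
  set z := LinearMap.adjoint S x with hz
  have h1 : ‖z‖ ≤ ‖x‖ := by
    have h : ‖z‖ * ‖z‖ ≤ ‖x‖ * ‖z‖ := by
      calc ‖z‖ * ‖z‖ = RCLike.re (inner ℂ z z) := (inner_self_eq_norm_mul_norm z).symm
        _ = RCLike.re (inner ℂ x (S z)) := by rw [hz, LinearMap.adjoint_inner_left]
        _ ≤ ‖x‖ * ‖S z‖ := re_inner_le_norm _ _
        _ ≤ ‖x‖ * ‖z‖ := by gcongr; exact hS z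
    rcases (norm_nonneg z).eq_or_lt with h0 | h0
    · rw [← h0]; exact norm_nonneg x
    · exact le_of_mul_le_mul_right h h0
  -- Expanding, `‖z - x‖² = ‖z‖² - ‖x‖² ≤ 0`.
  have h2 : z = x := by
    have h := @norm_sub_sq ℂ _ _ _ _ z x
    have h3 : RCLike.re (inner ℂ z x) = ‖x‖ ^ 2 := by
      rw [hz, LinearMap.adjoint_inner_left, hx, inner_self_eq_norm_sq]
    rw [h3] at h
    have h4 : ‖z - x‖ ^ 2 = 0 := by
      have := pow_le_pow_left₀ (norm_nonneg z) h1 2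
      nlinarith [sq_nonneg ‖z - x‖]
    rwa [sq_eq_zero_iff, norm_eq_zero, sub_eq_zero] at h4
  rw [← LinearMap.adjoint_inner_left, ← hz, h2]

/-- An idempotent contraction is an orthogonal projection. -/
theorem isSymmetricProjection_of_contraction {T : V →ₗ[ℂ] V} (hT : ∀ x, ‖T x‖ ≤ ‖x‖)
    (hi : T ∘ₗ T = T) : T.IsSymmetricProjection := by
  have hi' (x : V) : T (T x) = T x := LinearMap.congr_fun hi x
  refine ⟨hi, fun x y ↦ ?_⟩
  rw [← inner_map_eq_of_contraction hT (hi' x) y, ← inner_conj_symm (T x) (T y),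
    inner_map_eq_of_contraction hT (hi' y) x, inner_conj_symm]

theorem map_eq_self_of_norm_map_eq {T : V →ₗ[ℂ] V} (hT : ∀ x, ‖T x‖ ≤ ‖x‖)
    (hi : T ∘ₗ T = T) {x : V} (hx : ‖T x‖ = ‖x‖) : T x = x := by
  have hs := isSymmetricProjection_of_contraction hT hi
  have h := @norm_sub_sq ℂ _ _ _ _ (T x) x
  have h3 : RCLike.re (inner ℂ (T x) x) = ‖T x‖ ^ 2 := by
    rw [← inner_map_eq_of_contraction hT (LinearMap.congr_fun hi x) x, inner_self_eq_norm_sq]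
  rw [h3, hx] at h
  have h4 : ‖T x - x‖ ^ 2 = 0 := by rw [h]; ring
  rwa [sq_eq_zero_iff, norm_eq_zero, sub_eq_zero] at h4

/-- Compactness of the unit sphere turns pointwise strict contraction into a uniform one. -/
theorem norm_lt_one_of_forall_norm_map_lt {R : V →L[ℂ] V} (hR : ∀ x, x ≠ 0 → ‖R x‖ < ‖x‖) :
    ‖R‖ < 1 := by
  cases subsingleton_or_nontrivial V with
  | inl h =>
    have : R = 0 := ContinuousLinearMap.ext fun x ↦ Subsingleton.elim _ _
    simp [this]
  | inr h =>
    have := FiniteDimensional.proper ℂ V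
    obtain ⟨x, hx, hmax⟩ := (isCompact_sphere (0 : V) 1).exists_isMaxOn
      (NormedSpace.sphere_nonempty.2 zero_le_one) (f := fun x ↦ ‖R x‖) (by fun_prop)
    have hx1 : ‖x‖ = 1 := by simpa using hx
    refine lt_of_le_of_lt (ContinuousLinearMap.opNorm_le_of_unit_norm (𝕜 := ℂ) (norm_nonneg _)
      fun y hy ↦ hmax (by simpa using hy)) ?_
    exact hx1 ▸ hR x (by rintro rfl; simp at hx1)

/-- The powers of a contraction that preserves the norm of its fixed vectors only converge to the
orthogonal projection onto the fixed vectors. -/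
theorem exists_tendsto_iterate_of_contraction {S : V →ₗ[ℂ] V} (hS : ∀ x, ‖S x‖ ≤ ‖x‖)
    (hfix : ∀ x, ‖S x‖ = ‖x‖ → S x = x) :
    ∃ P : V →ₗ[ℂ] V, P.IsSymmetricProjection ∧ (∀ x, P x = x ↔ S x = x) ∧
      ∀ x, Tendsto (fun k : ℕ ↦ S^[k] x) atTop (𝓝 (P x)) := by
  let F : Submodule ℂ V := LinearMap.eqLocus S LinearMap.id
  have hF (x : V) : x ∈ F ↔ S x = x := Iff.rfl
  let P := F.starProjection
  have hPF (x : V) : P x ∈ F := F.starProjection_apply_mem x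
  have hPS (x : V) : S (P x) = P x := (hF _).1 (hPF x)
  have hperp {y : V} (hy : y ∈ Fᗮ) : S y ∈ Fᗮ := by
    rw [Submodule.mem_orthogonal] at hy ⊢
    intro u hu
    rw [inner_map_eq_of_contraction hS ((hF u).1 hu), hy u hu]
  -- `R` is `S` on `Fᗮ` and zero on `F`; its powers decay geometrically.
  let R : V →L[ℂ] V := S.toContinuousLinearMap ∘L Fᗮ.starProjection
  have hR : ‖R‖ < 1 := by
    refine norm_lt_one_of_forall_norm_map_lt fun x hx ↦ ?_
    have h1 : ‖R x‖ ≤ ‖Fᗮ.starProjection x‖ := hS _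
    have h2 : ‖Fᗮ.starProjection x‖ ≤ ‖x‖ := Fᗮ.norm_starProjection_apply_le x
    refine lt_of_le_of_ne (h1.trans h2) fun h ↦ hx ?_
    have h3 : x ∈ Fᗮ := (Fᗮ.mem_iff_norm_starProjection x).2 (le_antisymm h2 (h ▸ h1))
    have h4 : Fᗮ.starProjection x = x := Submodule.starProjection_eq_self_iff.2 h3
    have h5 : R x = S x := congrArg S h4
    have h6 : x ∈ F := hfix x (h5 ▸ h)
    simpa using Submodule.inner_right_of_mem_orthogonal h6 h3
  have hpow {y : V} (hy : y ∈ Fᗮ) (k : ℕ) : (R ^ k) y = S^[k] y ∧ S^[k] y ∈ Fᗮ := by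
    induction k with
    | zero => exact ⟨rfl, hy⟩
    | succ k ih =>
      rw [pow_succ', Function.iterate_succ_apply', mul_apply_eq_comp, ih.1]
      exact ⟨congrArg S (Submodule.starProjection_eq_self_iff.2 ih.2), hperp ih.2⟩
  refine ⟨P, Submodule.isSymmetricProjection_starProjection F, fun x ↦ ?_, fun x ↦ ?_⟩
  · exact Submodule.starProjection_eq_self_iff
  · have hy : x - P x ∈ Fᗮ := F.sub_starProjection_mem_orthogonal x
    have h0 : Tendsto (fun k : ℕ ↦ (R ^ k) (x - P x)) atTop (𝓝 0) := by
      have := ((ContinuousLinearMap.apply ℂ V (x - P x)).continuous.tendsto 0).comp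
        (tendsto_pow_atTop_nhds_zero_of_norm_lt_one hR)
      simpa [Function.comp_def] using this
    have h1 (k : ℕ) : S^[k] x = (R ^ k) (x - P x) + P x := by
      rw [(hpow hy k).1, ← Module.End.coe_pow, map_sub, Module.End.coe_pow,
        Function.iterate_fixed (hPS x), sub_add_cancel]
    simpa [h1] using h0.add_const (P x)

end Contraction

/-! ### Compositions over one cycle -/

section Cycle

theorem cycleMap_apply_eq_self {n : Type*} {r : ℕ} {E : Fin r → (Matrix n n ℂ →ₗ[ℂ] Matrix n n ℂ)}
    {X : Matrix n n ℂ} (h : ∀ i, E i X = X) : cycleMap r E X = X := by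
  induction r with
  | zero => rfl
  | succ r ih =>
    rw [cycleMap, LinearMap.comp_apply, ih fun i ↦ h _, h]

theorem cycleMap_induction {n : Type*} {p : (Matrix n n ℂ →ₗ[ℂ] Matrix n n ℂ) → Prop}
    (hid : p LinearMap.id) (hcomp : ∀ S T, p S → p T → p (S ∘ₗ T)) {r : ℕ}
    {E : Fin r → (Matrix n n ℂ →ₗ[ℂ] Matrix n n ℂ)} (h : ∀ i, p (E i)) : p (cycleMap r E) := by
  induction r with
  | zero => exact hid
  | succ r ih => exact hcomp _ _ (h _) (ih fun i ↦ h _)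

/-- No factor increases `N`, so equality over the cycle forces equality over the shorter cycle; by
induction its factors fix `X`, and the last factor then acts on `X` itself. -/
theorem apply_eq_self_of_norm_cycleMap_eq {n : Type*} {N : Matrix n n ℂ → ℝ} {r : ℕ}
    {E : Fin r → (Matrix n n ℂ →ₗ[ℂ] Matrix n n ℂ)} (hN : ∀ i X, N (E i X) ≤ N X)
    (hfix : ∀ i X, N (E i X) = N X → E i X = X) {X : Matrix n n ℂ}
    (hX : N (cycleMap r E X) = N X) (i : Fin r) : E i X = X := by
  induction r with
  | zero => exact i.elim0
  | succ r ih =>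
    have h1 : N (cycleMap r (fun i ↦ E i.castSucc) X) ≤ N X :=
      cycleMap_induction (p := fun S ↦ ∀ X, N (S X) ≤ N X) (fun _ ↦ le_rfl)
        (fun S T hS hT X ↦ (hS _).trans (hT X)) (fun i X ↦ hN _ X) X
    have h2 := ih (E := fun i ↦ E i.castSucc) (fun i ↦ hN _) (fun i ↦ hfix _)
      (le_antisymm h1 (hX ▸ hN (Fin.last r) _))
    refine Fin.lastCases ?_ h2 i
    rw [cycleMap, LinearMap.comp_apply, cycleMap_apply_eq_self h2] at hX
    exact hfix _ X hX

end Cycle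

/-! ### Complete positivity and the weighted Schwarz inequality -/

section CompletelyPositive

open Filter Topology

theorem CStarMatrix.star_fin_two {n : Type*} {a b c d : Matrix n n ℂ} :
    star (CStarMatrix.ofMatrix !![a, b; c, d]) =
      CStarMatrix.ofMatrix !![star a, star c; star b, star d] := by
  ext i j : 2
  fin_cases i <;> fin_cases j <;> rfl

theorem CStarMatrix.mul_fin_two {n : Type*} [Fintype n] {a b c d a' b' c' d' : Matrix n n ℂ} :
    CStarMatrix.ofMatrix !![a, b; c, d] * CStarMatrix.ofMatrix !![a', b'; c', d'] =
      CStarMatrix.ofMatrix !![a * a' + b * c', a * b' + b * d'; c * a' + d * c', c * b' + d * d'] :=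
  Matrix.mul_fin_two ..

theorem CStarMatrix.map_fin_two {n : Type*} {a b c d : Matrix n n ℂ} (E : Matrix n n ℂ →ₗ[ℂ] Matrix n n ℂ) :
    (CStarMatrix.ofMatrix !![a, b; c, d]).map E =
      CStarMatrix.ofMatrix !![E a, E b; E c, E d] := by
  ext i j : 2
  fin_cases i <;> fin_cases j <;> rfl

variable {n : Type*} [Fintype n] [DecidableEq n]

open scoped Matrix.Norms.L2Operator MatrixOrder ComplexOrder

theorem isCPTP_iff {E : Matrix n n ℂ →ₗ[ℂ] Matrix n n ℂ} :
    IsCPTP E ↔ (∀ (k : ℕ) (M : CStarMatrix (Fin k) (Fin k) (Matrix n n ℂ)), 0 ≤ M → 0 ≤ M.map E) ∧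
      ∀ X : Matrix n n ℂ, (E X).trace = X.trace := by
  refine and_congr_left fun _ ↦ ⟨?_, fun h ↦ ⟨⟨E, h⟩, rfl⟩⟩
  rintro ⟨φ, rfl⟩
  exact φ.map_cstarMatrix_nonneg'

theorem isCPTP_id : IsCPTP (LinearMap.id : Matrix n n ℂ →ₗ[ℂ] Matrix n n ℂ) :=
  isCPTP_iff.2 ⟨fun _ _ hM ↦ hM, fun _ ↦ rfl⟩

theorem IsCPTP.comp {S T : Matrix n n ℂ →ₗ[ℂ] Matrix n n ℂ} (hS : IsCPTP S) (hT : IsCPTP T) :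
    IsCPTP (S ∘ₗ T) := by
  rw [isCPTP_iff] at *
  exact ⟨fun k M hM ↦ hS.1 k _ (hT.1 k M hM), fun X ↦ (hS.2 _).trans (hT.2 X)⟩

theorem IsCPTP.pow {S : Matrix n n ℂ →ₗ[ℂ] Matrix n n ℂ} (hS : IsCPTP S) (k : ℕ) :
    IsCPTP (S ^ k) := by
  induction k with
  | zero => exact isCPTP_id
  | succ k ih => rw [pow_succ]; exact ih.comp hS

theorem IsCPTP.of_tendsto {S : ℕ → (Matrix n n ℂ →ₗ[ℂ] Matrix n n ℂ)}
    {P : Matrix n n ℂ →ₗ[ℂ] Matrix n n ℂ} (hS : ∀ k, IsCPTP (S k))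
    (h : ∀ X, Tendsto (fun k ↦ S k X) atTop (𝓝 (P X))) : IsCPTP P := by
  simp_rw [isCPTP_iff] at *
  refine ⟨fun k M hM ↦ ?_, fun X ↦ ?_⟩
  · have ht : Tendsto (fun l ↦ M.map (S l)) atTop (𝓝 (M.map P)) :=
      tendsto_pi_nhds.2 fun i ↦ tendsto_pi_nhds.2 fun j ↦ h (M i j)
    exact ge_of_tendsto' ht fun l ↦ (hS l).1 k M hM
  · have ht := ((continuous_id.matrix_trace).tendsto (P X)).comp (h X)
    refine tendsto_nhds_unique ht (tendsto_const_nhds.congr fun l ↦ ?_)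
    exact ((hS l).2 X).symm

theorem CStarMatrix.diag_nonneg {m : Type*} [Fintype m]
    {M : CStarMatrix m m (Matrix n n ℂ)}
    (hM : 0 ≤ M) (i : m) : 0 ≤ M i i := by
  rw [StarOrderedRing.nonneg_iff] at hM
  induction hM using AddSubmonoid.closure_induction with
  | mem M h =>
    obtain ⟨B, rfl⟩ := h
    change 0 ≤ (star B * B) i i
    rw [CStarMatrix.mul_apply]
    exact Finset.sum_nonneg fun j _ ↦ star_mul_self_nonneg (B j i)
  | zero => exact le_rfl
  | add M N _ _ hM hN => exact add_nonneg hM hN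

/-- The Schwarz inequality for completely positive maps fixing `ρ`, relative to `ρ`. -/
theorem IsCPTP.mul_inv_mul_le {E : Matrix n n ℂ →ₗ[ℂ] Matrix n n ℂ} (hE : IsCPTP E)
    {ρ : Matrix n n ℂ} (hρ : ρ.PosDef) (hfix : E ρ = ρ) (X : Matrix n n ℂ) :
    E X * ρ⁻¹ * star (E X) ≤ E (X * ρ⁻¹ * star X) := by
  have hu : IsUnit ρ.det := (Matrix.isUnit_iff_isUnit_det ρ).1 hρ.isUnit
  have hr : ρ * ρ⁻¹ = 1 := Matrix.mul_nonsing_inv ρ hu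
  have hl : ρ⁻¹ * ρ = 1 := Matrix.nonsing_inv_mul ρ hu
  have hs : star ρ⁻¹ = ρ⁻¹ := hρ.inv.isHermitian
  obtain ⟨b, hb⟩ := CStarAlgebra.nonneg_iff_eq_star_mul_self.1 hρ.posSemidef.nonneg
  -- With `ρ = b* b`, this block matrix is `B* B` for `B` with first row `b, b ρ⁻¹ X*` and second
  -- row zero.
  have hM : 0 ≤ CStarMatrix.ofMatrix !![ρ, star X; X, X * ρ⁻¹ * star X] := by
    have h := star_mul_self_nonneg (CStarMatrix.ofMatrix !![b, b * ρ⁻¹ * star X; 0, 0])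
    rw [CStarMatrix.star_fin_two, CStarMatrix.mul_fin_two] at h
    have h1 : star b * (b * ρ⁻¹ * star X) = star X := by
      rw [← mul_assoc, ← mul_assoc, ← hb, hr, one_mul]
    have h2 : X * ρ⁻¹ * star b * b = X := by
      rw [mul_assoc, ← hb, mul_assoc, hl, mul_one]
    have h3 : X * ρ⁻¹ * star b * (b * ρ⁻¹ * star X) = X * ρ⁻¹ * star X := by
      rw [← mul_assoc, ← mul_assoc, h2]
    have h4 : star (b * ρ⁻¹ * star X) = X * ρ⁻¹ * star b := by
      rw [star_mul, star_mul, star_star, hs, mul_assoc]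
    simpa only [star_zero, zero_mul, mul_zero, add_zero, h4, ← hb, h1, h2, h3] using h
  have hN := (isCPTP_iff.1 hE).1 2 _ hM
  rw [CStarMatrix.map_fin_two, hfix] at hN
  have hstar : E (star X) = star (E X) := by
    have h := hN.isSelfAdjoint.star_eq
    rw [CStarMatrix.star_fin_two] at h
    exact (congrFun (congrFun h 0) 1).symm
  -- Conjugation by the column `(-ρ⁻¹ E(X)*, 1)` leaves the Schur complement in the corner.
  have h := CStarMatrix.diag_nonneg (star_left_conjugate_nonneg hN
    (CStarMatrix.ofMatrix !![-(ρ⁻¹ * star (E X)), 0; 1, 0])) 0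
  rw [CStarMatrix.star_fin_two, CStarMatrix.mul_fin_two, CStarMatrix.mul_fin_two, hstar] at h
  have h' : 0 ≤ (star (-(ρ⁻¹ * star (E X))) * ρ + star 1 * E X) * -(ρ⁻¹ * star (E X)) +
      (star (-(ρ⁻¹ * star (E X))) * star (E X) + star 1 * E (X * ρ⁻¹ * star X)) * 1 := h
  rw [← sub_nonneg]
  convert h' using 1
  rw [star_neg, star_mul, star_star, hs, star_one, neg_mul, mul_assoc (E X) ρ⁻¹ ρ, hl]
  noncomm_ring

theorem IsCPTP.trace_mul_inv_mul_le {E : Matrix n n ℂ →ₗ[ℂ] Matrix n n ℂ} (hE : IsCPTP E)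
    {ρ : Matrix n n ℂ} (hρ : ρ.PosDef) (hfix : E ρ = ρ) (X : Matrix n n ℂ) :
    (E X * ρ⁻¹ * star (E X)).trace.re ≤ (X * ρ⁻¹ * star X).trace.re := by
  rw [← (isCPTP_iff.1 hE).2 (X * ρ⁻¹ * star X), ← sub_nonneg, ← Complex.sub_re,
    ← Matrix.trace_sub]
  have h : (E (X * ρ⁻¹ * star X) - E X * ρ⁻¹ * star (E X)).PosSemidef :=
    hE.mul_inv_mul_le hρ hfix X
  exact (RCLike.nonneg_iff.1 h.trace_nonneg).1

end CompletelyPositive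

/-! ### The Hilbert space defined by the fixed state -/

section Main

open Filter Topology

variable {n : Type*} [Fintype n] [DecidableEq n]

open scoped ComplexOrder MatrixOrder Matrix.Norms.L2Operator

theorem Matrix.PosSemidef.posDef_of_rank_eq {ρ : Matrix n n ℂ} (hρ : ρ.PosSemidef)
    (hr : ρ.rank = Fintype.card n) : ρ.PosDef := by
  rw [hρ.posDef_iff_isUnit, ← Matrix.mulVec_surjective_iff_isUnit]
  have h : LinearMap.range ρ.mulVecLin = ⊤ :=
    Submodule.eq_top_of_finrank_eq (by simpa [Matrix.rank] using hr)
  exact LinearMap.range_eq_top.1 h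

/-- A positive definite weight turns the space of matrices into a Hilbert space. -/
theorem exists_linearEquiv_norm_sq_eq {ρ : Matrix n n ℂ} (hρ : ρ.PosDef) :
    ∃ e : Matrix n n ℂ ≃ₗ[ℂ] EuclideanSpace ℂ (n × n),
      ∀ X, ‖e X‖ ^ 2 = (X * ρ⁻¹ * star X).trace.re := by
  -- For `ρ⁻¹ = b* b`, the isometry sends `X` to the entries of `X b*`.
  obtain ⟨b, hb, hbρ⟩ := CStarAlgebra.isStrictlyPositive_iff_eq_star_mul_self.1
    hρ.inv.isStrictlyPositive
  have hinj : Function.Injective (LinearMap.mulRight ℂ (star b)) := fun X Y h ↦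
    hb.star.mul_left_injective h
  refine ⟨(LinearEquiv.ofInjectiveEndo _ hinj).trans ((LinearEquiv.curry ℂ ℂ n n).symm.trans
    (WithLp.linearEquiv 2 ℂ (n × n → ℂ)).symm), fun X ↦ ?_⟩
  have h : X * ρ⁻¹ * star X = (X * star b) * star (X * star b) := by
    rw [hbρ, star_mul, star_star]; noncomm_ring
  rw [h, EuclideanSpace.norm_sq_eq, Fintype.sum_prod_type, Matrix.trace, Complex.re_sum]
  refine Finset.sum_congr rfl fun i _ ↦ ?_
  rw [Matrix.diag_apply, Matrix.mul_apply, Complex.re_sum]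
  refine Finset.sum_congr rfl fun j _ ↦ ?_
  rw [Matrix.star_apply, Complex.star_def, Complex.mul_conj, Complex.ofReal_re,
    Complex.normSq_eq_norm_sq]
  rfl

theorem IsCPTPProjectionOnto.apply_eq_self_iff {E : Matrix n n ℂ →ₗ[ℂ] Matrix n n ℂ}
    {A : Set (Matrix n n ℂ)} (hE : IsCPTPProjectionOnto E A) {X : Matrix n n ℂ} :
    E X = X ↔ X ∈ A := by
  rw [← hE.range_eq]
  refine ⟨fun h ↦ ⟨X, h⟩, ?_⟩
  rintro ⟨Y, rfl⟩
  exact LinearMap.congr_fun hE.idempotent Y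

end Main

theorem mainTheorem1 {n : Type*} [Fintype n] [DecidableEq n] (r : ℕ)
    (E : Fin r → (Matrix n n ℂ →ₗ[ℂ] Matrix n n ℂ)) (A : Fin r → Set (Matrix n n ℂ))
    (hE : ∀ i, IsCPTPProjectionOnto (E i) (A i))
    (hρ : ∃ ρ ∈ ⋂ i, A i, IsDensity ρ ∧ ρ.rank = Fintype.card n) :
    ∃ P : Matrix n n ℂ →ₗ[ℂ] Matrix n n ℂ,
      IsCPTPProjectionOnto P (⋂ i, A i) ∧
      (∀ Q : Matrix n n ℂ →ₗ[ℂ] Matrix n n ℂ, IsCPTPProjectionOnto Q (⋂ i, A i) → Q = P) ∧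
      ∀ τ : Matrix n n ℂ, IsDensity τ →
        Filter.Tendsto (fun k : ℕ => (cycleMap r E)^[k] τ) Filter.atTop (nhds (P τ)) := by
  obtain ⟨ρ, hρA, hρd, hρr⟩ := hρ
  have hpos := hρd.1.posDef_of_rank_eq hρr
  obtain ⟨e, he⟩ := exists_linearEquiv_norm_sq_eq hpos
  have hcontr {T : Matrix n n ℂ →ₗ[ℂ] Matrix n n ℂ} (hT : IsCPTP T) (h : T ρ = ρ)
      (X : Matrix n n ℂ) : ‖e (T X)‖ ≤ ‖e X‖ := by
    rw [← sq_le_sq₀ (norm_nonneg _) (norm_nonneg _), he, he]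
    exact hT.trace_mul_inv_mul_le hpos h X
  have hcontr' {T : Matrix n n ℂ →ₗ[ℂ] Matrix n n ℂ} (hT : IsCPTP T) (h : T ρ = ρ)
      (x : EuclideanSpace ℂ (n × n)) : ‖e.conj T x‖ ≤ ‖x‖ := by
    simpa [LinearEquiv.conj_apply_apply] using hcontr hT h (e.symm x)
  have hidem {T : Matrix n n ℂ →ₗ[ℂ] Matrix n n ℂ} (hT : T ∘ₗ T = T) :
      e.conj T ∘ₗ e.conj T = e.conj T := by
    rw [← LinearEquiv.conj_comp, hT]
  have hEρ (i : Fin r) : E i ρ = ρ := (hE i).apply_eq_self_iff.2 (Set.mem_iInter.1 hρA i)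
  have hcycle : IsCPTP (cycleMap r E) :=
    cycleMap_induction isCPTP_id (fun _ _ ↦ IsCPTP.comp) fun i ↦ (hE i).isCPTP
  have hfixE {i : Fin r} {X : Matrix n n ℂ} (h : ‖e (E i X)‖ = ‖e X‖) : E i X = X := by
    have := map_eq_self_of_norm_map_eq (hcontr' (hE i).isCPTP (hEρ i)) (hidem (hE i).idempotent)
      (x := e X) (by simpa [LinearEquiv.conj_apply_apply] using h)
    simpa [LinearEquiv.conj_apply_apply] using this
  have hfix {X : Matrix n n ℂ} (h : ‖e (cycleMap r E X)‖ = ‖e X‖) (i : Fin r) : E i X = X :=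
    apply_eq_self_of_norm_cycleMap_eq (N := fun X ↦ ‖e X‖)
      (fun i ↦ hcontr (hE i).isCPTP (hEρ i)) (fun i X ↦ hfixE) h i
  obtain ⟨P', hP', hP'fix, hlim'⟩ := exists_tendsto_iterate_of_contraction
    (hcontr' hcycle (cycleMap_apply_eq_self hEρ)) fun x hx ↦ by
      have hx' : ‖e (cycleMap r E (e.symm x))‖ = ‖e (e.symm x)‖ := by
        simpa [LinearEquiv.conj_apply_apply] using hx
      rw [LinearEquiv.conj_apply_apply, cycleMap_apply_eq_self (hfix hx'), e.apply_symm_apply]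
  let P := e.symm.conj P'
  have hPapply (X : Matrix n n ℂ) : P X = e.symm (P' (e X)) := by simp [P, LinearEquiv.conj_apply_apply]
  have hlim (X : Matrix n n ℂ) : Filter.Tendsto (fun k : ℕ ↦ (cycleMap r E)^[k] X) Filter.atTop
      (nhds (P X)) := by
    have h := ((LinearMap.continuous_of_finiteDimensional e.symm.toLinearMap).tendsto _).comp
      (hlim' (e X))
    rw [hPapply]
    refine h.congr fun k ↦ ?_
    have : Function.Semiconj e.symm (e.conj (cycleMap r E)) (cycleMap r E) := fun x ↦ by
      simp [LinearEquiv.conj_apply_apply]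
    simpa using this.iterate_right k (e X)
  have hPfix (X : Matrix n n ℂ) : P X = X ↔ X ∈ ⋂ i, A i := by
    rw [hPapply, LinearEquiv.symm_apply_eq, hP'fix, LinearEquiv.conj_apply_apply,
      e.symm_apply_apply, e.injective.eq_iff, Set.mem_iInter]
    refine ⟨fun h i ↦ (hE i).apply_eq_self_iff.1 (hfix (by rw [h]) i), fun h ↦
      cycleMap_apply_eq_self fun i ↦ (hE i).apply_eq_self_iff.2 (h i)⟩
  have hPidem : P ∘ₗ P = P := by
    rw [← LinearEquiv.conj_comp]
    exact congrArg _ hP'.isIdempotentElem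
  refine ⟨P, ⟨?_, hPidem, ?_⟩, fun Q hQ ↦ ?_, fun τ _ ↦ hlim τ⟩
  · exact IsCPTP.of_tendsto (S := fun k ↦ cycleMap r E ^ k) (fun k ↦ hcycle.pow k) fun X ↦ by
      simpa [Module.End.coe_pow] using hlim X
  · ext X
    rw [← hPfix]
    exact ⟨fun ⟨Y, hY⟩ ↦ hY ▸ LinearMap.congr_fun hPidem Y, fun h ↦ ⟨X, h⟩⟩
  -- `Q` also fixes `ρ`, so it too is orthogonal for the weighted product, with the same range as
  -- `P`.
  · have hQ' := isSymmetricProjection_of_contraction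
      (hcontr' hQ.isCPTP (hQ.apply_eq_self_iff.2 hρA)) (hidem hQ.idempotent)
    have h : e.conj Q = P' := by
      rw [hQ'.ext_iff hP']
      ext x
      rw [LinearMap.IsIdempotentElem.mem_range_iff hQ'.isIdempotentElem,
        LinearMap.IsIdempotentElem.mem_range_iff hP'.isIdempotentElem,
        LinearEquiv.conj_apply_apply, ← LinearEquiv.eq_symm_apply, hQ.apply_eq_self_iff, ← hPfix,
        hPapply, e.apply_symm_apply, e.symm.injective.eq_iff]
    refine LinearMap.ext fun X ↦ ?_
    rw [hPapply, ← h]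
    simp [LinearEquiv.conj_apply_apply]
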